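/- For each sufficiently large $n$ let $X_1,\dots,X_n$ (whose joint distribution may depend on $n$) be identically distributed, $1$-dependent random variables with values in the non-negative integers, where $1$-dependent means that $\sigma(X_1,\dots,X_s)$ and $\sigma(X_t,\dots,X_n)$ are independent whenever $1\le s<t\le n$ and $t-s>1$. Assume also that $E X_kX_{k+1}\le E X_1X_2$ for $1\le k<n$ (with equality, for instance, if the sequence is stationary). Let $x=x(n)$ be a positive integer and put $$S_n=X_1+\dots+X_n,\quad \nu_1=E X_1>0,\quad \nu_2=E X_1(X_1-1),\quad y=\frac{x-n\nu_1}{n\nu_1}.$$ Suppose that for some constant $C_0\ge 1$ not depending on $n$, and for all sufficiently large $n$, $$X_1\le C_0\ \text{a.s.},\quad e^{5C_0}\nu_1\le 0.002,\quad |y|\le \tfrac1{10},\quad \nu_2\le \frac{\nu_1e^{-1.5C_0}}{20},\quad E X_1X_2\le \frac{\nu_1e^{-1.5C_0}}{20},\quad x>n\nu_1.$$ Let $\gamma=e^{1.5C_0}\max(\nu_1^2,\nu_2,E X_1X_2)$ and let $Z_n^*$ be a Poisson random variable with parameter $n\lambda^*$, where $\lambda^*=\nu_1\bigl(1-\frac{\nu_1}{1-\nu_1}y\bigr)$.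 If $x-n\nu_1=O(\sqrt{n\nu_1})$, $\gamma=O(\nu_1^2)$ and $n\nu_1^3=o(1)$ as $n\to\infty$, then $$\frac{P(S_n\ge x)}{P(Z_n^*\ge x)}=1+o(1)\qquad (n\to\infty).$$ -/

import Mathlib

open MeasureTheory ProbabilityTheory Filter Topology Asymptotics

noncomputable section

namespace PoissonLD

variable {Ω : Type*} [MeasurableSpace Ω]

/-- The variables `X 1, …, X n` are `m`-dependent under `P`: whenever `t - s > m`, the σ-algebras
generated by `X 1, …, X s` and by `X t, …, X n` are independent. Indices start at `1`; the values
of `X` outside `1, …, n` play no role. -/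
def MDependent (m n : ℕ) (P : Measure Ω) (X : ℕ → Ω → ℕ) : Prop :=
  ∀ s t : ℕ, 1 ≤ s → s + m < t → t ≤ n →
    Indep (⨆ i ∈ Set.Icc 1 s, MeasurableSpace.comap (X i) ⊤)
      (⨆ i ∈ Set.Icc t n, MeasurableSpace.comap (X i) ⊤) P

/-- First factorial moment `E X₁`. -/
def nu1 (P : Measure Ω) (X : ℕ → Ω → ℕ) : ℝ := ∫ ω, (X 1 ω : ℝ) ∂P

/-- Second factorial moment `E X₁ (X₁ - 1)`. -/
def nu2 (P : Measure Ω) (X : ℕ → Ω → ℕ) : ℝ := ∫ ω, (X 1 ω : ℝ) * ((X 1 ω : ℝ) - 1) ∂P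

/-- The mixed moment `E X_k X_{k+1}`. -/
def mixedMoment (P : Measure Ω) (X : ℕ → Ω → ℕ) (k : ℕ) : ℝ :=
  ∫ ω, (X k ω : ℝ) * (X (k + 1) ω : ℝ) ∂P

/-- `γ = e^{1.5 C₀} max(ν₁², ν₂, E X₁X₂)`. -/
def gam (C₀ : ℝ) (P : Measure Ω) (X : ℕ → Ω → ℕ) : ℝ :=
  Real.exp (1.5 * C₀) * max (nu1 P X ^ 2) (max (nu2 P X) (mixedMoment P X 1))

/-- `y = (x - n ν₁) / (n ν₁)`. -/
def yParam (n : ℕ) (P : Measure Ω) (X : ℕ → Ω → ℕ) (x : ℕ) : ℝ :=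
  ((x : ℝ) - n * nu1 P X) / (n * nu1 P X)

/-- `λ* = ν₁ (1 - ν₁ y / (1 - ν₁))`. -/
def lamStar (n : ℕ) (P : Measure Ω) (X : ℕ → Ω → ℕ) (x : ℕ) : ℝ :=
  nu1 P X * (1 - nu1 P X / (1 - nu1 P X) * yParam n P X x)

/-- `S_n = X₁ + ⋯ + X_n`. -/
def partialSum (n : ℕ) (X : ℕ → Ω → ℕ) (ω : Ω) : ℕ := ∑ k ∈ Finset.Icc 1 n, X k ω

/-- The standing assumptions on one row `X 1, …, X n` and one point `x`. -/
structure Setting (C₀ : ℝ) (n : ℕ) (P : Measure Ω) (X : ℕ → Ω → ℕ) (x : ℕ) : Prop where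
  measurable : ∀ k, 1 ≤ k → k ≤ n → Measurable (X k)
  identDistrib : ∀ k, 1 ≤ k → k ≤ n → IdentDistrib (X k) (X 1) P P
  oneDependent : MDependent 1 n P X
  /-- `E X₁X₂` controls the mixed moment of every pair of neighbours (as it does, with equality,
  for a stationary sequence). -/
  mixedMoment_le : ∀ k, 1 ≤ k → k + 1 ≤ n → mixedMoment P X k ≤ mixedMoment P X 1
  x_pos : 0 < x
  /-- `y` is well defined. -/
  nu1_pos : 0 < nu1 P X
  bounded : ∀ᵐ ω ∂P, (X 1 ω : ℝ) ≤ C₀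
  nu1_small : Real.exp (5 * C₀) * nu1 P X ≤ 0.002
  y_small : |yParam n P X x| ≤ 1 / 10
  nu2_small : nu2 P X ≤ nu1 P X * Real.exp (-(1.5 * C₀)) / 20
  mixed_small : mixedMoment P X 1 ≤ nu1 P X * Real.exp (-(1.5 * C₀)) / 20

end PoissonLD

end

/-! At a bounded number of standard deviations above the mean, the tail of Poisson(`n ν₁`) stays
above a positive constant. An additive error tending to `0` is therefore already a relative error
tending to `0`, and no large-deviation expansion is needed.

Two additive errors occur. Replacing `S_n` by Poisson(`n ν₁`) costs at most `(ν₂ + 2 E X₁X₂ + 3 ν₁²)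
/ ν₁` by the Chen–Stein method (`Setting.abs_tail_sub_le`), which is `O(ν₁)` because `γ = O(ν₁²)`.
Here `ν₁ → 0`, since `n ν₁` is bounded below and `n ν₁³ → 0`. Replacing `n ν₁` by `n λ* = n ν₁ - d`
costs at most `e^d - 1` (`abs_poissonBelow_sub_le`), where `d = O(ν₁ √(n ν₁)) = O(√(n ν₁³)) → 0`.
The constant lower bound is `poisson_tail_lower`. -/

namespace PoissonLD

/-! ### Poisson weights: moments, change of parameter, lower bound for the tail. -/

/-- The weight `e^{-l} l^k / k!` of the Poisson law. -/
noncomputable def poissonWeight (l : ℝ) (k : ℕ) : ℝ := Real.exp (-l) * l ^ k / (k.factorial : ℝ)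

/-- The Poisson probability of `{0, …, x - 1}`. -/
noncomputable def poissonBelow (l : ℝ) (x : ℕ) : ℝ := ∑ i ∈ Finset.range x, poissonWeight l i

lemma poissonWeight_pos {l : ℝ} (hl : 0 < l) (k : ℕ) : 0 < poissonWeight l k := by
  unfold poissonWeight; positivity

lemma poissonWeight_succ (l : ℝ) (k : ℕ) :
    ((k : ℝ) + 1) * poissonWeight l (k + 1) = l * poissonWeight l k := by
  unfold poissonWeight
  rw [Nat.factorial_succ, pow_succ]
  push_cast
  field_simp

lemma hasSum_poissonWeight (l : ℝ) : HasSum (poissonWeight l) 1 := by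
  have h := (NormedSpace.expSeries_div_hasSum_exp l).mul_left (Real.exp (-l))
  rw [← Real.exp_eq_exp_ℝ, ← Real.exp_add, neg_add_cancel, Real.exp_zero] at h
  convert! h using 1
  ext k
  simp only [poissonWeight, mul_div_assoc]

lemma hasSum_poissonWeight_mul (l : ℝ) : HasSum (fun k : ℕ => (k : ℝ) * poissonWeight l k) l := by
  rw [← hasSum_nat_add_iff' 1]
  convert! (hasSum_poissonWeight l).mul_left l using 1
  · ext k
    push_cast
    exact poissonWeight_succ l k
  · simp

lemma hasSum_poissonWeight_mul_sub (l : ℝ) :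
    HasSum (fun k : ℕ => (k : ℝ) * ((k : ℝ) - 1) * poissonWeight l k) (l ^ 2) := by
  rw [← hasSum_nat_add_iff' 1]
  convert! (hasSum_poissonWeight_mul l).mul_left l using 1
  · ext k
    have := poissonWeight_succ l k
    push_cast
    linear_combination (k : ℝ) * this
  · simp [sq]

/-- The variance of the Poisson law. -/
lemma hasSum_poissonWeight_sq (l : ℝ) :
    HasSum (fun k : ℕ => ((k : ℝ) - l) ^ 2 * poissonWeight l k) l := by
  convert! ((hasSum_poissonWeight_mul_sub l).add
    ((hasSum_poissonWeight_mul l).mul_left (1 - 2 * l))).add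
    ((hasSum_poissonWeight l).mul_left (l ^ 2)) using 1
  · ext k; ring
  · ring

lemma hasSum_poissonWeight_tail (l : ℝ) (x : ℕ) :
    HasSum (fun j => poissonWeight l (j + x)) (1 - poissonBelow l x) :=
  (hasSum_nat_add_iff' x).2 (hasSum_poissonWeight l)

lemma poissonBelow_nonneg {l : ℝ} (hl : 0 < l) (x : ℕ) : 0 ≤ poissonBelow l x :=
  Finset.sum_nonneg fun i _ => (poissonWeight_pos hl i).le

lemma poissonBelow_le_one {l : ℝ} (hl : 0 < l) (x : ℕ) : poissonBelow l x ≤ 1 := by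
  have := (hasSum_poissonWeight_tail l x).nonneg fun j => (poissonWeight_pos hl _).le
  linarith

lemma poissonBelow_succ (l : ℝ) (x : ℕ) :
    poissonBelow l (x + 1) = poissonBelow l x + poissonWeight l x :=
  Finset.sum_range_succ _ _

lemma poissonMeasure_real_Ici (l : ℝ) (hl : 0 ≤ l) (x : ℕ) :
    (poissonMeasure l.toNNReal).real (Set.Ici x) = 1 - poissonBelow l x := by
  have h1 : (Set.Ici x : Set ℕ) = (↑(Finset.range x) : Set ℕ)ᶜ := by
    ext k; simp
  rw [h1, probReal_compl_eq_one_sub (Finset.measurableSet _), ← sum_measureReal_singleton]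
  simp only [poissonMeasure_real_singleton, Real.coe_toNNReal l hl]
  rfl

/-- Perturbing the parameter of a Poisson law. -/
lemma abs_poissonBelow_sub_le {l d : ℝ} (hd : 0 ≤ d) (hdl : d < l) (x : ℕ) :
    |poissonBelow (l - d) x - poissonBelow l x| ≤ Real.exp d - 1 := by
  have hl : 0 < l := by linarith
  -- Lowering the parameter raises a weight by at most the factor `e^d`. Summing below `x` and from
  -- `x` on bounds the change in both directions.
  have hw : ∀ k, poissonWeight (l - d) k ≤ Real.exp d * poissonWeight l k := by
    intro k
    have h : (l - d) ^ k ≤ l ^ k := pow_le_pow_left₀ (by linarith) (by linarith) k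
    unfold poissonWeight
    rw [show -(l - d) = d + -l by ring, Real.exp_add, mul_div_assoc, mul_div_assoc, mul_assoc]
    gcongr
  have h1 : poissonBelow (l - d) x ≤ Real.exp d * poissonBelow l x := by
    unfold poissonBelow
    rw [Finset.mul_sum]
    exact Finset.sum_le_sum fun i _ => hw i
  have h2 : 1 - poissonBelow (l - d) x ≤ Real.exp d * (1 - poissonBelow l x) :=
    hasSum_le (fun j => hw _) (hasSum_poissonWeight_tail _ x)
      ((hasSum_poissonWeight_tail l x).mul_left _)
  have h3 := poissonBelow_nonneg hl x
  have h4 := poissonBelow_le_one hl x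
  have h5 : 1 ≤ Real.exp d := Real.one_le_exp hd
  rw [abs_le]
  constructor <;> nlinarith

/-- A lower bound for the weights above the mode. -/
lemma poissonWeight_add_ge {l : ℝ} (hl : 0 < l) (k s : ℕ) (hk : l ≤ k + s) :
    poissonWeight l k * Real.exp (-(s * ((k + s - l) / l))) ≤ poissonWeight l (k + s) := by
  -- Consecutive weights have ratio `l / (k + j)`, which is at least `l / (k + s)` for `1 ≤ j ≤ s`.
  have h1 : ∀ j ≤ s, poissonWeight l k * (l / (k + s)) ^ j ≤ poissonWeight l (k + j) := by
    intro j hj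
    induction j with
    | zero => simp
    | succ j ih =>
      have ih := ih (by omega)
      have hjs : (j : ℝ) + 1 ≤ s := by exact_mod_cast hj
      have hk0 : (0 : ℝ) ≤ k := k.cast_nonneg
      have hj0 : (0 : ℝ) ≤ j := j.cast_nonneg
      have h := poissonWeight_succ l (k + j)
      have h' : poissonWeight l (k + (j + 1)) = l / (k + j + 1) * poissonWeight l (k + j) := by
        rw [← add_assoc]
        push_cast at h
        field_simp
        linarith
      rw [h', pow_succ]
      calc poissonWeight l k * ((l / (k + s)) ^ j * (l / (k + s)))
          = l / (k + s) * (poissonWeight l k * (l / (k + s)) ^ j) := by ring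
        _ ≤ l / (k + j + 1) * poissonWeight l (k + j) := by
            have := (poissonWeight_pos hl k).le
            have : (k : ℝ) + j + 1 ≤ k + s := by linarith
            gcongr
  refine le_trans ?_ (h1 s le_rfl)
  have hks : 0 < (k : ℝ) + s := by linarith
  have h2 : Real.exp (-((k + s - l) / l)) ≤ l / (k + s) := by
    rw [Real.exp_neg, inv_le_comm₀ (Real.exp_pos _) (by positivity), inv_div]
    have := Real.add_one_le_exp ((k + s - l) / l)
    have e : (k + s - l) / l + 1 = (k + s) / l := by field_simp; ring
    linarith
  have h3 : Real.exp (-(s * ((k + s - l) / l))) ≤ (l / (k + s)) ^ s := by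
    rw [show -(s * ((k + s - l) / l)) = s * (-((k + s - l) / l)) by ring, Real.exp_nat_mul]
    gcongr
  exact mul_le_mul_of_nonneg_left h3 (poissonWeight_pos hl k).le

/-- The upper tail of the Poisson law at a bounded number of standard deviations above the mean
is bounded below. -/
lemma poisson_tail_lower {l B : ℝ} (hl : 10 / 11 ≤ l) (hB : 0 ≤ B) (x : ℕ)
    (hx : (x : ℝ) ≤ l + B * Real.sqrt l) :
    3 / 4 * Real.exp (-((B + 5) * (B + 7))) ≤ 1 - poissonBelow l x := by
  have hl0 : 0 < l := by linarith
  set r := Real.sqrt l with hr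
  have hr2 : r ^ 2 = l := Real.sq_sqrt hl0.le
  have hr0 : 0 ≤ r := Real.sqrt_nonneg l
  have hr1 : 9 / 10 ≤ r := by nlinarith
  -- A shift by `s` carries every point within `2 √l` of the mean to at least `l + B √l ≥ x`, and
  -- each weight there loses at most the factor `c`.
  set s := ⌈(B + 2) * r⌉₊ with hs
  have hs1 : (B + 2) * r ≤ s := Nat.le_ceil _
  have hs2 : (s : ℝ) < (B + 2) * r + 1 := Nat.ceil_lt_add_one (by positivity)
  set c := Real.exp (-((B + 5) * (B + 7)))
  set g : ℕ → ℝ := fun k => if x ≤ k then poissonWeight l k else 0 with hg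
  have hgsum : HasSum g (1 - poissonBelow l x) := by
    rw [← hasSum_nat_add_iff' x]
    convert! hasSum_poissonWeight_tail l x using 1
    · ext j; simp [hg]
    · rw [Finset.sum_eq_zero]
      · simp
      · intro i hi
        simp [hg, Finset.mem_range.1 hi]
  have hg0 : ∀ k, 0 ≤ g k := fun k => by
    simp only [hg]; split_ifs
    · exact (poissonWeight_pos hl0 k).le
    · exact le_rfl
  have hinj : Function.Injective fun k : ℕ => k + s := add_left_injective s
  have hshift : Summable fun k => g (k + s) := hgsum.summable.comp_injective hinj
  have hle : ∑' k, g (k + s) ≤ 1 - poissonBelow l x := by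
    rw [← hgsum.tsum_eq]
    exact tsum_comp_le_tsum_of_inj hgsum.summable hg0 hinj
  -- Chebyshev in summed form: `1 - (k - l)² / (4 l)` is at most the indicator of `|k - l| ≤ 2 √l`,
  -- and its Poisson mean is `3/4`.
  have hq := ((hasSum_poissonWeight l).sub
    ((hasSum_poissonWeight_sq l).mul_left (1 / (4 * l)))).mul_left c
  have hmain : c * (1 - 1 / (4 * l) * l) ≤ ∑' k, g (k + s) := by
    refine hasSum_le (fun k => ?_) hq hshift.hasSum
    have hp := poissonWeight_pos hl0 k
    have hc0 : 0 < c := Real.exp_pos _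
    by_cases hk : ((k : ℝ) - l) ^ 2 ≤ 4 * l
    · have hk' : |(k : ℝ) - l| ≤ 2 * r := abs_le_of_sq_le_sq (by nlinarith) (by positivity)
      rw [abs_le] at hk'
      have hxk : x ≤ k + s := by
        have : (x : ℝ) ≤ ((k + s : ℕ) : ℝ) := by push_cast; nlinarith
        exact_mod_cast this
      simp only [hg, hxk, if_true]
      have h1 := poissonWeight_add_ge hl0 k s (by nlinarith)
      have h2 : c ≤ Real.exp (-(s * ((k + s - l) / l))) := by
        apply Real.exp_le_exp.2
        apply neg_le_neg
        rw [← mul_div_assoc, div_le_iff₀ hl0]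
        have a1 : (s : ℝ) ≤ (B + 5) * r := by nlinarith
        have a2 : (k : ℝ) + s - l ≤ (B + 7) * r := by nlinarith
        calc (s : ℝ) * (k + s - l) ≤ ((B + 5) * r) * ((B + 7) * r) := by
              apply mul_le_mul a1 a2 _ (by positivity)
              nlinarith
          _ = (B + 5) * (B + 7) * l := by rw [← hr2]; ring
      have h3 : 0 ≤ 1 / (4 * l) * (((k : ℝ) - l) ^ 2 * poissonWeight l k) := by positivity
      nlinarith
    · refine le_trans ?_ (hg0 _)
      have : 1 ≤ 1 / (4 * l) * ((k : ℝ) - l) ^ 2 := by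
        rw [one_div, ← div_eq_inv_mul, le_div_iff₀ (by positivity)]
        linarith
      apply mul_nonpos_of_nonneg_of_nonpos hc0.le
      nlinarith
  have : 1 / (4 * l) * l = 1 / 4 := by field_simp
  rw [this] at hmain
  linarith

/-! ### The Stein equation for the Poisson law -/

/-- The ratios satisfy `R (k+1) = 1 + (k+1)/l * R k`, whose coefficients grow with `k`, so
monotonicity propagates by induction. This makes the Stein solution increase below `x`. -/
lemma poissonBelow_ratio_mono {l : ℝ} (hl : 0 < l) (k : ℕ) :
    poissonBelow l (k + 1) / poissonWeight l k ≤
      poissonBelow l (k + 2) / poissonWeight l (k + 1) := by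
  have step : ∀ k : ℕ, poissonBelow l (k + 2) / poissonWeight l (k + 1) =
      1 + (k + 1) / l * (poissonBelow l (k + 1) / poissonWeight l k) := by
    intro k
    have h := poissonWeight_succ l k
    have h0 := poissonWeight_pos hl k
    have h1 := poissonWeight_pos hl (k + 1)
    rw [poissonBelow_succ l (k + 1)]
    field_simp
    linear_combination (-poissonBelow l (k + 1)) * h
  induction k with
  | zero =>
    rw [step 0]
    have h0 := poissonWeight_pos hl 0
    simp [poissonBelow, div_self h0.ne']
    positivity
  | succ k ih =>
    rw [step (k + 1), step k]
    have := div_nonneg (poissonBelow_nonneg hl (k + 1)) (poissonWeight_pos hl k).le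
    push_cast
    gcongr
    · linarith
    · rw [← step k]; exact ih

/-- After cross-multiplication the inequality holds term by term, by log-concavity of the weights.
This makes the Stein solution decrease from `x - 1` on. -/
lemma poissonTail_ratio_anti {l : ℝ} (hl : 0 < l) (k : ℕ) :
    (1 - poissonBelow l (k + 2)) / poissonWeight l (k + 1) ≤
      (1 - poissonBelow l (k + 1)) / poissonWeight l k := by
  rw [div_le_div_iff₀ (poissonWeight_pos hl _) (poissonWeight_pos hl _)]
  refine hasSum_le (fun j => ?_) ((hasSum_poissonWeight_tail l (k + 2)).mul_right _)
    ((hasSum_poissonWeight_tail l (k + 1)).mul_right _)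
  have h1 := poissonWeight_succ l (j + (k + 1))
  have h2 := poissonWeight_succ l k
  have e : j + (k + 2) = j + (k + 1) + 1 := by ring
  rw [e]
  have p1 := poissonWeight_pos hl (j + (k + 1))
  have p2 := poissonWeight_pos hl (k + 1)
  have p3 := poissonWeight_pos hl (j + (k + 1) + 1)
  have hj : (0 : ℝ) ≤ j := j.cast_nonneg
  have hk : (0 : ℝ) ≤ k := k.cast_nonneg
  push_cast at h1
  have h3 : l * (poissonWeight l (j + (k + 1) + 1) * poissonWeight l k) ≤
      l * (poissonWeight l (j + (k + 1)) * poissonWeight l (k + 1)) := by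
    have : l * (poissonWeight l (j + (k + 1)) * poissonWeight l (k + 1)) -
        l * (poissonWeight l (j + (k + 1) + 1) * poissonWeight l k) =
        (j + 1) * (poissonWeight l (j + (k + 1) + 1) * poissonWeight l (k + 1)) := by
      linear_combination poissonWeight l (j + (k + 1) + 1) * h2 - poissonWeight l (k + 1) * h1
    have : 0 ≤ ((j : ℝ) + 1) * (poissonWeight l (j + (k + 1) + 1) * poissonWeight l (k + 1)) := by
      positivity
    linarith
  exact le_of_mul_le_mul_left h3 hl

/-- The bounded solution `f` of the Stein equation for the indicator of `{0, …, x - 1}`, where `x`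
exceeds the mean, has increments at most `1 / l`. -/
theorem exists_stein_solution {l : ℝ} (hl : 0 < l) (x : ℕ) (hx : l < x) :
    ∃ f : ℕ → ℝ,
      (∀ k : ℕ, l * f (k + 1) - k * f k = (if k < x then 1 else 0) - poissonBelow l x) ∧
      (∀ k : ℕ, |f (k + 1) - f k| ≤ 1 / l) ∧ ∃ M, ∀ k, |f k| ≤ M := by
  set F := poissonBelow l x with hF
  have hF0 : 0 ≤ F := poissonBelow_nonneg hl x
  have hF1 : F ≤ 1 := poissonBelow_le_one hl x
  -- `u k` plays the role of `f (k + 1)`. It is unimodal with peak at `x - 1`, where the two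
  -- branches agree because `poissonBelow l x = F`.
  set u : ℕ → ℝ := fun k =>
    if k < x then (1 - F) * (poissonBelow l (k + 1) / poissonWeight l k) / l
    else F * ((1 - poissonBelow l (k + 1)) / poissonWeight l k) / l with hu
  have hpos : ∀ k, 0 < poissonWeight l k := poissonWeight_pos hl
  have hu0 : ∀ k, 0 ≤ u k := by
    intro k
    have h1 := poissonBelow_nonneg hl (k + 1)
    have h2 := sub_nonneg.2 (poissonBelow_le_one hl (k + 1))
    have h3 := (hpos k).le
    have h4 := sub_nonneg.2 hF1
    simp only [hu]
    split_ifs <;> positivity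
  have hrec0 : l * u 0 = (if 0 < x then 1 else 0) - F := by
    have hx0 : 0 < x := by
      have : (0 : ℝ) < x := hl.trans hx
      exact_mod_cast this
    have := (hpos 0).ne'
    simp only [hu, hx0, if_true]
    simp [poissonBelow]
    field_simp
  have hlast : ∀ k, k + 1 = x → u k = F * ((1 - poissonBelow l (k + 1)) / poissonWeight l k) / l := by
    intro k hk
    have hk' : k < x := by omega
    simp only [hu, hk', if_true]
    rw [hk, ← hF]
    ring
  have hrec : ∀ k : ℕ, l * u (k + 1) - (k + 1) * u k = (if k + 1 < x then 1 else 0) - F := by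
    intro k
    have h := poissonWeight_succ l k
    have h0 := hpos k
    have h1 := hpos (k + 1)
    have hs := poissonBelow_succ l (k + 1)
    by_cases hk : k + 1 < x
    · have hk' : k < x := by omega
      simp only [hu, hk, hk', if_true]
      rw [show k + 1 + 1 = k + 2 from rfl] at *
      rw [hs]
      field_simp
      linear_combination (-(1 - F) * poissonBelow l (k + 1)) * h
    · have e : u k = F * ((1 - poissonBelow l (k + 1)) / poissonWeight l k) / l := by
        by_cases hk' : k < x
        · exact hlast k (by omega)
        · simp only [hu, hk', if_false]
      rw [e]
      simp only [hu, hk, if_false]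
      rw [show k + 1 + 1 = k + 2 from rfl] at *
      rw [hs]
      field_simp
      linear_combination (-F * (1 - poissonBelow l (k + 1))) * h
  have hup : ∀ k, k + 1 < x → u k ≤ u (k + 1) := by
    intro k hk
    have hk' : k < x := by omega
    simp only [hu, hk, hk', if_true]
    have := poissonBelow_ratio_mono hl k
    have h4 := sub_nonneg.2 hF1
    gcongr
  have hdown : ∀ k, x ≤ k + 1 → u (k + 1) ≤ u k := by
    intro k hk
    have e : u k = F * ((1 - poissonBelow l (k + 1)) / poissonWeight l k) / l := by
      by_cases hk' : k < x
      · exact hlast k (by omega)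
      · simp only [hu, hk', if_false]
    rw [e]
    simp only [hu, not_lt.2 hk, if_false]
    have := poissonTail_ratio_anti hl k
    gcongr
  obtain ⟨m, rfl⟩ : ∃ m, x = m + 1 := by
    cases x with
    | zero => exact absurd hx (by simp [hl.le])
    | succ m => exact ⟨m, rfl⟩
  have hmax1 : ∀ k, k ≤ m → u k ≤ u m := by
    intro k hk
    induction hk using Nat.decreasingInduction with
    | self => exact le_rfl
    | of_succ j hj ih => exact (hup j (by omega)).trans ih
  have hmax2 : ∀ k, m ≤ k → u k ≤ u m := by
    intro k hk
    induction k, hk using Nat.le_induction with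
    | base => exact le_rfl
    | succ j hj ih => exact (hdown j (by omega)).trans ih
  have hmax : ∀ k, u k ≤ u m := fun k => (le_total k m).elim (hmax1 k) (hmax2 k)
  have hdiff : ∀ k, |l * (u (k + 1) - u k)| ≤ 1 := by
    intro k
    have r := hrec k
    have k0 := hu0 k
    push_cast at hx
    rw [abs_le]
    by_cases hk : k + 1 < m + 1
    · have h := hup k hk
      simp only [hk, if_true] at r
      refine ⟨by nlinarith, ?_⟩
      have rm := hrec m
      have hd := hdown m le_rfl
      simp only [lt_irrefl, if_false] at rm
      -- The recurrence at the peak together with `u (m + 1) ≤ u m`. Since `l < m + 1` and `u k ≤ u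
      -- m`, the bound passes to all `k < m`, where the scaled increment is `1 - F + (k + 1 - l) u
      -- k`.
      have h1 : ((m : ℝ) + 1 - l) * u m ≤ F := by nlinarith
      have hkm : (k : ℝ) ≤ m := by exact_mod_cast (by omega : k ≤ m)
      have h2 : ((k : ℝ) + 1 - l) * u k ≤ F := by
        refine le_trans ?_ h1
        have := hmax k
        calc ((k : ℝ) + 1 - l) * u k ≤ ((m : ℝ) + 1 - l) * u k := by gcongr
          _ ≤ _ := by gcongr
      nlinarith
    · have h := hdown k (by omega)
      simp only [hk, if_false] at r
      have hkm : (m : ℝ) ≤ k := by exact_mod_cast (by omega : m ≤ k)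
      have h2 : 0 ≤ ((k : ℝ) + 1 - l) * u k := by
        apply mul_nonneg _ k0
        linarith
      constructor <;> nlinarith
  -- At `k = 0` truncated subtraction gives `f 0 = u 0`. The Stein equation multiplies `f 0` by `0`,
  -- and the first increment vanishes.
  refine ⟨fun k => u (k - 1), ?_, ?_, u m, fun k => ?_⟩
  · intro k
    cases k with
    | zero => simpa using hrec0
    | succ k => simpa using hrec k
  · intro k
    cases k with
    | zero => simp [hl.le]
    | succ k =>
      have := hdiff k
      rw [abs_mul, abs_of_pos hl] at this
      rw [le_div_iff₀ hl, mul_comm]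
      exact this
  · rw [abs_of_nonneg (hu0 _)]
    exact hmax _


/-! ### Rows padded by zeros, so that end points need no separate treatment. -/

/-- The variables `X 1, …, X n`, extended by `0` to all indices. -/
def truncated {Ω : Type*} (n : ℕ) (X : ℕ → Ω → ℕ) (j : ℕ) (ω : Ω) : ℕ :=
  if 1 ≤ j ∧ j ≤ n then X j ω else 0

lemma truncated_eq_zero {Ω : Type*} {n j : ℕ} (X : ℕ → Ω → ℕ) (h : ¬(1 ≤ j ∧ j ≤ n)) :
    truncated n X j = fun _ => 0 := by
  ext ω; simp [truncated, h]

lemma truncated_eq {Ω : Type*} {n j : ℕ} (X : ℕ → Ω → ℕ) (h : 1 ≤ j ∧ j ≤ n) : truncated n X j = X j := by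
  ext ω; simp [truncated, h]

/-- The decomposition `W + (Y + R)` around the index `a + 1`: distant part, the variable itself, its
two neighbours. -/
lemma sum_truncated_split {Ω : Type*} {n a : ℕ} (X : ℕ → Ω → ℕ) (ha : a < n) (ω : Ω) :
    partialSum n X ω = ((∑ j ∈ Finset.range a, truncated n X j ω) +
        ∑ j ∈ Finset.Ico (a + 3) (n + 3), truncated n X j ω) +
      (truncated n X (a + 1) ω + (truncated n X a ω + truncated n X (a + 2) ω)) := by
  have h1 : partialSum n X ω = ∑ j ∈ Finset.range (n + 3), truncated n X j ω := by
    unfold partialSum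
    rw [Finset.sum_congr rfl fun j hj => congrFun (truncated_eq X (Finset.mem_Icc.1 hj)).symm ω]
    apply Finset.sum_subset
    · intro j hj
      have := Finset.mem_Icc.1 hj
      exact Finset.mem_range.2 (by omega)
    · intro j _ hj
      rw [truncated_eq_zero X fun h => hj (Finset.mem_Icc.2 h)]
  rw [h1, ← Finset.sum_range_add_sum_Ico _ (by omega : a + 3 ≤ n + 3), Finset.sum_range_succ,
    Finset.sum_range_succ, Finset.sum_range_succ]
  ring

lemma measurable_truncated_iSup {Ω : Type*} {n s t j : ℕ} (X : ℕ → Ω → ℕ)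
    (h : 1 ≤ j → j ≤ n → s ≤ j ∧ j ≤ t) :
    Measurable[⨆ i ∈ Set.Icc s t, MeasurableSpace.comap (X i) ⊤] (truncated n X j) := by
  by_cases hj : 1 ≤ j ∧ j ≤ n
  · rw [truncated_eq X hj]
    refine Measurable.of_comap_le ?_
    exact le_iSup₂_of_le (f := fun i _ => MeasurableSpace.comap (X i) ⊤) j (h hj.1 hj.2) le_rfl
  · rw [truncated_eq_zero X hj]
    exact measurable_const

/-! ### Independence of non-neighbours and the local Stein error. -/

section Probability

variable {Ω : Type*} [MeasurableSpace Ω] {μ : Measure Ω}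

/-- If `(U, Y)` is independent of `V`, and `U` of `Y`, then `Y` is independent of `(U, V)`. -/
lemma indepFun_prodMk_of_indepFun [IsProbabilityMeasure μ] {U Y V : Ω → ℕ}
    (hU : Measurable U) (hY : Measurable Y) (hV : Measurable V)
    (hUY : IndepFun U Y μ) (hUV : IndepFun U V μ)
    (hUYV : IndepFun (fun ω => (U ω, Y ω)) V μ) :
    IndepFun Y (fun ω => (U ω, V ω)) μ := by
  rw [indepFun_iff_map_prod_eq_prod_map_map hY.aemeasurable (hU.prodMk hV).aemeasurable]
  refine Measure.ext_of_singleton fun ⟨y, u, v⟩ => ?_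
  rw [Measure.map_apply (by fun_prop) (measurableSet_singleton _),
    ← Set.singleton_prod_singleton, Measure.prod_prod,
    Measure.map_apply hY (measurableSet_singleton _),
    Measure.map_apply (by fun_prop) (measurableSet_singleton _)]
  -- On atoms: `P(u, y, v) = P(u, y) P(v) = P(u) P(y) P(v) = P(y) P(u, v)`.
  have h1 := hUYV.measure_inter_preimage_eq_mul {(u, y)} {v} (measurableSet_singleton _)
    (measurableSet_singleton _)
  have h2 := hUY.measure_inter_preimage_eq_mul {u} {y} (measurableSet_singleton _)
    (measurableSet_singleton _)
  have h3 := hUV.measure_inter_preimage_eq_mul {u} {v} (measurableSet_singleton _)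
    (measurableSet_singleton _)
  have e1 : (fun ω => (Y ω, U ω, V ω)) ⁻¹' ({y} ×ˢ {(u, v)}) =
      (fun ω => (U ω, Y ω)) ⁻¹' {(u, y)} ∩ V ⁻¹' {v} := by
    ext ω; simp; tauto
  have e2 : (fun ω => (U ω, Y ω)) ⁻¹' {(u, y)} = U ⁻¹' {u} ∩ Y ⁻¹' {y} := by
    ext ω; simp
  have e3 : (fun ω => (U ω, V ω)) ⁻¹' {(u, v)} = U ⁻¹' {u} ∩ V ⁻¹' {v} := by
    ext ω; simp
  rw [e1, h1, e2, h2, e3, h3]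
  ring

lemma abs_sub_le_of_increment {f : ℕ → ℝ} {K : ℝ} (hf : ∀ k, |f (k + 1) - f k| ≤ K) (a d : ℕ) :
    |f (a + d) - f a| ≤ K * d := by
  induction d with
  | zero => simp
  | succ d ih =>
    have h := abs_sub_le (f (a + (d + 1))) (f (a + d)) (f a)
    have h' := hf (a + d)
    rw [add_assoc] at h'
    push_cast
    linarith

/-- The contribution of one summand `Y` to the Stein functional of `W + (Y + R)`, where `Y` is
independent of `W`. -/
lemma stein_local_error [IsProbabilityMeasure μ] {f : ℕ → ℝ} {K M C : ℝ}
    (hf : ∀ k, |f (k + 1) - f k| ≤ K) (hM : ∀ k, |f k| ≤ M)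
    {W Y R : Ω → ℕ} (hW : Measurable W) (hY : Measurable Y) (hR : Measurable R)
    (hYC : ∀ᵐ ω ∂μ, (Y ω : ℝ) ≤ C) (hRC : ∀ᵐ ω ∂μ, (R ω : ℝ) ≤ C)
    (hind : IndepFun Y W μ) :
    |∫ ω, (Y ω : ℝ) * f (W ω + (Y ω + R ω)) ∂μ -
        (∫ ω, (Y ω : ℝ) ∂μ) * ∫ ω, f (W ω + (Y ω + R ω) + 1) ∂μ| ≤
      K * ((∫ ω, (Y ω : ℝ) * ((Y ω : ℝ) - 1) ∂μ) + (∫ ω, (Y ω : ℝ) * (R ω : ℝ) ∂μ) +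
        (∫ ω, (Y ω : ℝ) ∂μ) * ((∫ ω, (Y ω : ℝ) ∂μ) + ∫ ω, (R ω : ℝ) ∂μ)) := by
  have hfm : Measurable f := measurable_from_top
  have hYr : Measurable fun ω => (Y ω : ℝ) := measurable_from_top.comp hY
  have hRr : Measurable fun ω => (R ω : ℝ) := measurable_from_top.comp hR
  have iY : Integrable (fun ω => (Y ω : ℝ)) μ :=
    Integrable.of_bound hYr.aestronglyMeasurable C (by simpa using hYC)
  have iR : Integrable (fun ω => (R ω : ℝ)) μ :=
    Integrable.of_bound hRr.aestronglyMeasurable C (by simpa using hRC)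
  have iYY : Integrable (fun ω => (Y ω : ℝ) * ((Y ω : ℝ) - 1)) μ :=
    (iY.sub (integrable_const 1)).bdd_mul hYr.aestronglyMeasurable (c := C) (by simpa using hYC)
  have iYR : Integrable (fun ω => (Y ω : ℝ) * (R ω : ℝ)) μ :=
    iR.bdd_mul hYr.aestronglyMeasurable (c := C) (by simpa using hYC)
  have mf : ∀ Z : Ω → ℕ, Measurable Z → Integrable (fun ω => f (Z ω)) μ := fun Z hZ =>
    Integrable.of_bound (hfm.comp hZ).aestronglyMeasurable M (ae_of_all _ fun ω => hM _)
  have iYf : ∀ Z : Ω → ℕ, Measurable Z → Integrable (fun ω => (Y ω : ℝ) * f (Z ω)) μ :=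
    fun Z hZ => (mf Z hZ).bdd_mul hYr.aestronglyMeasurable (c := C) (by simpa using hYC)
  have hS : Measurable fun ω => W ω + (Y ω + R ω) := hW.add (hY.add hR)
  have hS1 : Measurable fun ω => W ω + (Y ω + R ω) + 1 := hS.add_const 1
  have hW1 : Measurable fun ω => W ω + 1 := hW.add_const 1
  -- Both integrals are compared with `f (W + 1)`, at which independence factorises exactly. The
  -- argument `W + 1` rather than `W` turns the error `Y²` into `Y (Y - 1)`.
  have hprod : ∫ ω, (Y ω : ℝ) * f (W ω + 1) ∂μ =
      (∫ ω, (Y ω : ℝ) ∂μ) * ∫ ω, f (W ω + 1) ∂μ :=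
    hind.integral_fun_comp_mul_comp (f := fun k : ℕ => (k : ℝ)) (g := fun k => f (k + 1))
      hY.aemeasurable hW.aemeasurable (measurable_from_top.aestronglyMeasurable)
      (measurable_from_top.aestronglyMeasurable)
  have h1 : |∫ ω, (Y ω : ℝ) * f (W ω + (Y ω + R ω)) ∂μ - ∫ ω, (Y ω : ℝ) * f (W ω + 1) ∂μ| ≤
      K * ((∫ ω, (Y ω : ℝ) * ((Y ω : ℝ) - 1) ∂μ) + ∫ ω, (Y ω : ℝ) * (R ω : ℝ) ∂μ) := by
    rw [← integral_sub (iYf _ hS) (iYf _ hW1), ← integral_add iYY iYR, ← integral_const_mul]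
    refine (abs_integral_le_integral_abs).trans
      (integral_mono ((iYf _ hS).sub (iYf _ hW1)).abs ((iYY.add iYR).const_mul K) fun ω => ?_)
    have hpt : |(Y ω : ℝ) * f (W ω + (Y ω + R ω)) - (Y ω : ℝ) * f (W ω + 1)| ≤
        K * ((Y ω : ℝ) * ((Y ω : ℝ) - 1) + (Y ω : ℝ) * (R ω : ℝ)) := by
      cases hy : Y ω with
      | zero => simp
      | succ y =>
        have h := abs_sub_le_of_increment hf (W ω + 1) (y + R ω)
        rw [show W ω + 1 + (y + R ω) = W ω + (y + 1 + R ω) by ring] at h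
        rw [← mul_sub, abs_mul, Nat.abs_cast]
        calc ((y + 1 : ℕ) : ℝ) * |f (W ω + (y + 1 + R ω)) - f (W ω + 1)|
            ≤ ((y + 1 : ℕ) : ℝ) * (K * ((y + R ω : ℕ) : ℝ)) := by gcongr
          _ = _ := by push_cast; ring
    exact hpt
  have h2 : |∫ ω, f (W ω + (Y ω + R ω) + 1) ∂μ - ∫ ω, f (W ω + 1) ∂μ| ≤
      K * ((∫ ω, (Y ω : ℝ) ∂μ) + ∫ ω, (R ω : ℝ) ∂μ) := by
    rw [← integral_sub (mf _ hS1) (mf _ hW1), ← integral_add iY iR, ← integral_const_mul]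
    refine (abs_integral_le_integral_abs).trans
      (integral_mono ((mf _ hS1).sub (mf _ hW1)).abs ((iY.add iR).const_mul K) fun ω => ?_)
    have h := abs_sub_le_of_increment hf (W ω + 1) (Y ω + R ω)
    rw [show W ω + 1 + (Y ω + R ω) = W ω + (Y ω + R ω) + 1 by ring] at h
    push_cast at h
    exact h
  have hEY : 0 ≤ ∫ ω, (Y ω : ℝ) ∂μ := integral_nonneg fun ω => Nat.cast_nonneg _
  have h3 := mul_le_mul_of_nonneg_left h2 hEY
  rw [← abs_of_nonneg hEY, ← abs_mul, abs_of_nonneg hEY] at h3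
  rw [hprod] at h1
  have h4 := abs_le.1 h1
  have h5 := abs_le.1 h3
  rw [abs_le]
  constructor <;> nlinarith [h4.1, h4.2, h5.1, h5.2]

/-- Independence of the σ-algebras of past and future, including the empty ones. -/
lemma MDependent.indep_of_add_lt [IsProbabilityMeasure μ] {m n : ℕ} {X : ℕ → Ω → ℕ}
    (h : MDependent m n μ X) {s t : ℕ} (hst : s + m < t) :
    Indep (⨆ i ∈ Set.Icc 1 s, MeasurableSpace.comap (X i) ⊤)
      (⨆ i ∈ Set.Icc t n, MeasurableSpace.comap (X i) ⊤) μ := by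
  by_cases hs : 1 ≤ s
  · by_cases ht : t ≤ n
    · exact h s t hs hst ht
    · rw [Set.Icc_eq_empty (a := t) ht]
      simpa using indep_bot_right _
  · rw [Set.Icc_eq_empty (b := s) hs]
    simpa using indep_bot_left _

lemma indepFun_of_indep_of_measurable {β β' : Type*} [MeasurableSpace β]
    [MeasurableSpace β'] {m₁ m₂ : MeasurableSpace Ω} (h : Indep m₁ m₂ μ) {g : Ω → β} {g' : Ω → β'}
    (hg : Measurable[m₁] g) (hg' : Measurable[m₂] g') : IndepFun g g' μ :=
  indep_of_indep_of_le_left (indep_of_indep_of_le_right h hg'.comap_le) hg.comap_le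

/-- Each variable is independent of the sum of those that are not its neighbours. -/
lemma MDependent.indepFun_far [IsProbabilityMeasure μ] {n : ℕ} {X : ℕ → Ω → ℕ}
    (hX : ∀ j, Measurable (truncated n X j)) (h : MDependent 1 n μ X) (a : ℕ) :
    IndepFun (truncated n X (a + 1))
      (fun ω => (∑ j ∈ Finset.range a, truncated n X j ω) +
        ∑ j ∈ Finset.Ico (a + 3) (n + 3), truncated n X j ω) μ := by
  set U : Ω → ℕ := fun ω => ∑ j ∈ Finset.range a, truncated n X j ω with hU
  set V : Ω → ℕ := fun ω => ∑ j ∈ Finset.Ico (a + 3) (n + 3), truncated n X j ω with hV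
  have mU : Measurable U := Finset.measurable_fun_sum _ fun j _ => hX j
  have mV : Measurable V := Finset.measurable_fun_sum _ fun j _ => hX j
  -- `U` involves only `X 1, …, X (a - 1)`. Taking `s = a - 1` separates it from `X (a + 1)`, and `s
  -- = a + 1` separates it, jointly with `X (a + 1)`, from `V`.
  have mU' : ∀ s, a - 1 ≤ s →
      Measurable[⨆ i ∈ Set.Icc 1 s, MeasurableSpace.comap (X i) ⊤] U := by
    intro s hs
    refine Finset.measurable_fun_sum _ fun j hj => measurable_truncated_iSup X fun h1 _ => ?_
    have := Finset.mem_range.1 hj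
    omega
  have mV' : Measurable[⨆ i ∈ Set.Icc (a + 3) n, MeasurableSpace.comap (X i) ⊤] V := by
    refine Finset.measurable_fun_sum _ fun j hj => measurable_truncated_iSup X fun _ h2 => ?_
    have := Finset.mem_Ico.1 hj
    omega
  have mY : Measurable[⨆ i ∈ Set.Icc 1 (a + 1), MeasurableSpace.comap (X i) ⊤]
      (truncated n X (a + 1)) := measurable_truncated_iSup X fun h1 _ => ⟨h1, le_rfl⟩
  have mY' : Measurable[⨆ i ∈ Set.Icc (a + 1) n, MeasurableSpace.comap (X i) ⊤]
      (truncated n X (a + 1)) := measurable_truncated_iSup X fun _ h1 => ⟨le_rfl, h1⟩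
  have hUY : IndepFun U (truncated n X (a + 1)) μ := by
    cases a with
    | zero =>
      have : U = fun _ => 0 := by ext ω; simp [hU]
      rw [this]
      exact indepFun_const_left _ _
    | succ a =>
      exact indepFun_of_indep_of_measurable (h.indep_of_add_lt (s := a) (by omega)) (mU' _ (by omega)) mY'
  have hI := h.indep_of_add_lt (s := a + 1) (t := a + 3) (by omega)
  have hUV : IndepFun U V μ := indepFun_of_indep_of_measurable hI (mU' _ (by omega)) mV'
  have hUYV : IndepFun (fun ω => (U ω, truncated n X (a + 1) ω)) V μ :=
    indepFun_of_indep_of_measurable hI ((mU' _ (by omega)).prodMk mY) mV'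
  exact (indepFun_prodMk_of_indepFun mU (hX _) mV hUY hUV hUYV).comp (φ := id)
    (ψ := fun q : ℕ × ℕ => q.1 + q.2) measurable_id (by fun_prop)

end Probability


/-! ### The Chen–Stein bound for the tail. -/

section ChenStein

variable {Ω : Type*} [MeasurableSpace Ω] {μ : Measure Ω}

/-- Chen–Stein bound for the tails of a sum of `1`-dependent variables. -/
theorem Setting.abs_tail_sub_le [IsProbabilityMeasure μ] {C₀ : ℝ} {n : ℕ} {X : ℕ → Ω → ℕ} {x : ℕ}
    (h : Setting C₀ n μ X x) (hC₀ : 0 ≤ C₀) (hn : 0 < n) (hx : (n : ℝ) * nu1 μ X < x) :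
    |μ.real {ω | x ≤ partialSum n X ω} - (1 - poissonBelow (n * nu1 μ X) x)| ≤
      1 / (n * nu1 μ X) * (n * (nu2 μ X + 2 * mixedMoment μ X 1 + 3 * nu1 μ X ^ 2)) := by
  have hn0 : (0 : ℝ) < n := by exact_mod_cast hn
  have hν := h.nu1_pos
  set l := (n : ℝ) * nu1 μ X with hl
  have hl0 : 0 < l := by positivity
  obtain ⟨f, hf, hinc, M, hM⟩ := exists_stein_solution hl0 x hx
  have mT : ∀ j, Measurable (truncated n X j) := by
    intro j
    by_cases hj : 1 ≤ j ∧ j ≤ n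
    · rw [truncated_eq X hj]; exact h.measurable j hj.1 hj.2
    · rw [truncated_eq_zero X hj]; exact measurable_const
  have bT : ∀ j, ∀ᵐ ω ∂μ, (truncated n X j ω : ℝ) ≤ C₀ := by
    intro j
    by_cases hj : 1 ≤ j ∧ j ≤ n
    · rw [truncated_eq X hj]
      exact ((h.identDistrib j hj.1 hj.2).symm.ae_snd (p := fun k : ℕ => (k : ℝ) ≤ C₀)
        (Set.to_countable _).measurableSet) h.bounded
    · rw [truncated_eq_zero X hj]; simpa using hC₀
  have mTr : ∀ j, Measurable fun ω => (truncated n X j ω : ℝ) := fun j =>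
    measurable_from_top.comp (mT j)
  have iT : ∀ j, Integrable (fun ω => (truncated n X j ω : ℝ)) μ := fun j =>
    Integrable.of_bound (mTr j).aestronglyMeasurable C₀ (by simpa using bT j)
  have iTT : ∀ j k, Integrable (fun ω => (truncated n X j ω : ℝ) * (truncated n X k ω : ℝ)) μ :=
    fun j k => (iT k).bdd_mul (mTr j).aestronglyMeasurable (c := C₀) (by simpa using bT j)
  have eT : ∀ j, 1 ≤ j ∧ j ≤ n → ∫ ω, (truncated n X j ω : ℝ) ∂μ = nu1 μ X := by
    intro j hj
    rw [truncated_eq X hj]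
    exact ((h.identDistrib j hj.1 hj.2).comp
      (u := fun k : ℕ => (k : ℝ)) measurable_from_top).integral_eq
  have eT2 : ∀ j, 1 ≤ j ∧ j ≤ n →
      ∫ ω, (truncated n X j ω : ℝ) * ((truncated n X j ω : ℝ) - 1) ∂μ = nu2 μ X := by
    intro j hj
    rw [truncated_eq X hj]
    exact ((h.identDistrib j hj.1 hj.2).comp
      (u := fun k : ℕ => (k : ℝ) * ((k : ℝ) - 1)) measurable_from_top).integral_eq
  have leT : ∀ j, ∫ ω, (truncated n X j ω : ℝ) ∂μ ≤ nu1 μ X := by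
    intro j
    by_cases hj : 1 ≤ j ∧ j ≤ n
    · exact (eT j hj).le
    · rw [truncated_eq_zero X hj]; simpa using hν.le
  have hm0 : 0 ≤ mixedMoment μ X 1 := integral_nonneg fun ω => by positivity
  have leTT : ∀ j, ∫ ω, (truncated n X j ω : ℝ) * (truncated n X (j + 1) ω : ℝ) ∂μ ≤
      mixedMoment μ X 1 := by
    intro j
    by_cases hj : 1 ≤ j ∧ j + 1 ≤ n
    · rw [truncated_eq X ⟨hj.1, by omega⟩, truncated_eq X ⟨by omega, hj.2⟩]
      exact h.mixedMoment_le j hj.1 hj.2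
    · by_cases hj0 : 1 ≤ j ∧ j ≤ n
      · rw [truncated_eq_zero X (j := j + 1) (by omega)]; simpa using hm0
      · rw [truncated_eq_zero X hj0]; simpa using hm0
  have mS : Measurable (partialSum n X) :=
    Finset.measurable_fun_sum _ fun j hj =>
      h.measurable j (Finset.mem_Icc.1 hj).1 (Finset.mem_Icc.1 hj).2
  have mf : ∀ Z : Ω → ℕ, Measurable Z → Integrable (fun ω => f (Z ω)) μ := fun Z hZ =>
    Integrable.of_bound ((measurable_from_top (f := f)).comp hZ).aestronglyMeasurable M
      (ae_of_all _ fun ω => hM _)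
  have mS1 : Measurable fun ω => partialSum n X ω + 1 := mS.add_const 1
  have iTf : ∀ j, Integrable (fun ω => (truncated n X j ω : ℝ) * f (partialSum n X ω)) μ :=
    fun j => (mf _ mS).bdd_mul (mTr j).aestronglyMeasurable (c := C₀) (by simpa using bT j)
  have hloc : ∀ k ∈ Finset.Icc 1 n,
      |∫ ω, (truncated n X k ω : ℝ) * f (partialSum n X ω) ∂μ -
        nu1 μ X * ∫ ω, f (partialSum n X ω + 1) ∂μ| ≤
      1 / l * (nu2 μ X + 2 * mixedMoment μ X 1 + 3 * nu1 μ X ^ 2) := by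
    intro k hk
    obtain ⟨a, rfl⟩ : ∃ a, k = a + 1 := ⟨k - 1, by have := Finset.mem_Icc.1 hk; omega⟩
    have hk' := Finset.mem_Icc.1 hk
    have mR : Measurable fun ω => truncated n X a ω + truncated n X (a + 2) ω :=
      (mT a).add (mT (a + 2))
    -- The bound `2 * C₀` accommodates the two neighbours collected in `R`. Their means also give
    -- the `3 ν₁²`, as `ν₁ (ν₁ + 2 ν₁)`.
    have hloc := stein_local_error (C := 2 * C₀) hinc hM
      (W := fun ω => (∑ j ∈ Finset.range a, truncated n X j ω) +
        ∑ j ∈ Finset.Ico (a + 3) (n + 3), truncated n X j ω)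
      ((Finset.measurable_fun_sum _ fun j _ => mT j).add
        (Finset.measurable_fun_sum _ fun j _ => mT j))
      (mT (a + 1)) mR
      ((bT (a + 1)).mono fun ω hω => by linarith)
      (by filter_upwards [bT a, bT (a + 2)] with ω h1 h2; push_cast; linarith)
      (h.oneDependent.indepFun_far mT a)
    simp only [← sum_truncated_split X (by omega : a < n), eT _ hk', eT2 _ hk'] at hloc
    refine hloc.trans (mul_le_mul_of_nonneg_left ?_ (by positivity))
    have hYR : ∫ ω, (truncated n X (a + 1) ω : ℝ) *
        ((truncated n X a ω + truncated n X (a + 2) ω : ℕ) : ℝ) ∂μ ≤ 2 * mixedMoment μ X 1 := by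
      have e : ∀ ω, (truncated n X (a + 1) ω : ℝ) *
          ((truncated n X a ω + truncated n X (a + 2) ω : ℕ) : ℝ) =
          (truncated n X a ω : ℝ) * (truncated n X (a + 1) ω : ℝ) +
          (truncated n X (a + 1) ω : ℝ) * (truncated n X (a + 1 + 1) ω : ℝ) := by
        intro ω; push_cast; ring
      simp only [e]
      rw [integral_add (iTT _ _) (iTT _ _)]
      linarith [leTT a, leTT (a + 1)]
    have hR : ∫ ω, ((truncated n X a ω + truncated n X (a + 2) ω : ℕ) : ℝ) ∂μ ≤
        2 * nu1 μ X := by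
      push_cast
      rw [integral_add (iT _) (iT _)]
      linarith [leT a, leT (a + 2)]
    nlinarith
  have hsum : ∫ ω, (partialSum n X ω : ℝ) * f (partialSum n X ω) ∂μ =
      ∑ k ∈ Finset.Icc 1 n, ∫ ω, (truncated n X k ω : ℝ) * f (partialSum n X ω) ∂μ := by
    rw [← integral_finsetSum _ fun k _ => iTf k]
    refine integral_congr_ae (ae_of_all _ fun ω => ?_)
    simp only [← Finset.sum_mul]
    congr 1
    rw [partialSum, Nat.cast_sum]
    exact Finset.sum_congr rfl fun k hk => by rw [truncated_eq X (Finset.mem_Icc.1 hk)]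
  have iSf : Integrable (fun ω => (partialSum n X ω : ℝ) * f (partialSum n X ω)) μ := by
    refine (integrable_finsetSum (Finset.Icc 1 n) fun k _ => iTf k).congr
      (ae_of_all _ fun ω => ?_)
    simp only [← Finset.sum_mul]
    congr 1
    rw [partialSum, Nat.cast_sum]
    exact Finset.sum_congr rfl fun k hk => by rw [truncated_eq X (Finset.mem_Icc.1 hk)]
  -- The Stein equation at `S_n`, integrated; passing to the complementary event reverses the sign.
  have hstein : μ.real {ω | x ≤ partialSum n X ω} - (1 - poissonBelow l x) =
      (∫ ω, (partialSum n X ω : ℝ) * f (partialSum n X ω) ∂μ) -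
        l * ∫ ω, f (partialSum n X ω + 1) ∂μ := by
    have hset : MeasurableSet {ω | x ≤ partialSum n X ω} := mS measurableSet_Ici
    rw [← integral_const_mul, ← integral_sub iSf ((mf _ mS1).const_mul l),
      ← integral_indicator_one hset]
    have : (1 - poissonBelow l x) = ∫ _, (1 - poissonBelow l x) ∂μ := by simp
    have hind : Integrable ({ω | x ≤ partialSum n X ω}.indicator (1 : Ω → ℝ)) μ :=
      (integrable_const (1 : ℝ)).indicator hset
    rw [this, ← integral_sub hind (integrable_const _)]
    refine integral_congr_ae (ae_of_all _ fun ω => ?_)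
    have := hf (partialSum n X ω)
    by_cases hω : x ≤ partialSum n X ω
    · have h1 := not_lt.2 hω
      simp only [h1, if_false] at this
      simp [hω]
      linarith
    · have h1 := not_le.1 hω
      simp only [h1, if_true] at this
      simp [hω]
      linarith
  have hcard : l * ∫ ω, f (partialSum n X ω + 1) ∂μ =
      ∑ k ∈ Finset.Icc 1 n, nu1 μ X * ∫ ω, f (partialSum n X ω + 1) ∂μ := by
    simp [hl, mul_assoc]
  rw [hstein, hsum, hcard, ← Finset.sum_sub_distrib]
  refine (Finset.abs_sum_le_sum_abs _ _).trans ((Finset.sum_le_sum hloc).trans (le_of_eq ?_))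
  simp
  ring

end ChenStein

/-! ### Asymptotics and the main theorem. -/

/-- A ratio tends to `1` if the difference tends to `0` and one term is bounded below. -/
lemma tendsto_div_one_of_abs_sub_le {a b e : ℕ → ℝ} {c : ℝ} (hc : 0 < c)
    (he : Tendsto e atTop (𝓝 0)) (hab : ∀ᶠ n in atTop, |a n - b n| ≤ e n)
    (hb : ∀ᶠ n in atTop, c ≤ b n) : Tendsto (fun n => a n / b n) atTop (𝓝 1) := by
  rw [tendsto_iff_norm_sub_tendsto_zero]
  refine squeeze_zero' (g := fun n => e n / c) (Eventually.of_forall fun n => norm_nonneg _) ?_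
    (by simpa using he.div_const c)
  filter_upwards [hab, hb] with n h1 h2
  have hbn : 0 < b n := hc.trans_le h2
  rw [Real.norm_eq_abs, div_sub_one hbn.ne', abs_div, abs_of_pos hbn]
  exact div_le_div₀ ((abs_nonneg _).trans h1) h1 hc h2

end PoissonLD

theorem corollary2
    (C₀ : ℝ) (hC₀ : 1 ≤ C₀)
    (Ω : ℕ → Type*) [∀ n, MeasurableSpace (Ω n)]
    (P : ∀ n, Measure (Ω n)) [∀ n, IsProbabilityMeasure (P n)]
    (X : ∀ n, ℕ → Ω n → ℕ) (x : ℕ → ℕ)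
    (hset : ∀ᶠ n in atTop, PoissonLD.Setting C₀ n (P n) (X n) (x n))
    (hx : ∀ᶠ n : ℕ in atTop, (n : ℝ) * PoissonLD.nu1 (P n) (X n) < (x n : ℝ))
    (hxO : (fun n : ℕ => (x n : ℝ) - n * PoissonLD.nu1 (P n) (X n))
      =O[atTop] (fun n : ℕ => Real.sqrt (n * PoissonLD.nu1 (P n) (X n))))
    (hγ : (fun n : ℕ => PoissonLD.gam C₀ (P n) (X n))
      =O[atTop] (fun n : ℕ => PoissonLD.nu1 (P n) (X n) ^ 2))
    (hν : (fun n : ℕ => (n : ℝ) * PoissonLD.nu1 (P n) (X n) ^ 3)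
      =o[atTop] (fun _ => (1 : ℝ))) :
    Tendsto (fun n : ℕ =>
      (P n).real {ω | x n ≤ PoissonLD.partialSum n (X n) ω} /
        (poissonMeasure
          (Real.toNNReal (n * PoissonLD.lamStar n (P n) (X n) (x n)))).real (Set.Ici (x n)))
      atTop (𝓝 1) := by
  have hq : Tendsto (fun n : ℕ => (n : ℝ) * PoissonLD.nu1 (P n) (X n) ^ 3) atTop (𝓝 0) :=
    (isLittleO_one_iff ℝ).1 hν
  obtain ⟨K, hK⟩ := hγ.bound
  obtain ⟨B, hB0, hB⟩ := hxO.exists_nonneg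
  have hB := hB.bound
  -- The constant `10 / 11` comes from `1 ≤ x ≤ (1 + 1/10) n ν₁`.
  have hbasic : ∀ᶠ n : ℕ in atTop, 0 < PoissonLD.nu1 (P n) (X n) ∧
      PoissonLD.nu1 (P n) (X n) ≤ 1 / 2 ∧ 10 / 11 ≤ (n : ℝ) * PoissonLD.nu1 (P n) (X n) := by
    filter_upwards [hset, eventually_gt_atTop 0] with n hs hn
    have hn0 : (0 : ℝ) < n := by exact_mod_cast hn
    have hp := hs.nu1_pos
    have h1 : (1 : ℝ) ≤ Real.exp (5 * C₀) := Real.one_le_exp (by linarith)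
    have h2 := hs.nu1_small
    refine ⟨hp, by nlinarith, ?_⟩
    have h3 := (abs_le.1 hs.y_small).2
    unfold PoissonLD.yParam at h3
    rw [div_le_iff₀ (by positivity)] at h3
    have h4 : (1 : ℝ) ≤ x n := by exact_mod_cast hs.x_pos
    linarith
  -- From `n ν₁ ≥ 10 / 11` follows `ν₁² ≤ (11/10) n ν₁³`.
  have hν0 : Tendsto (fun n : ℕ => PoissonLD.nu1 (P n) (X n)) atTop (𝓝 0) := by
    have h2 : Tendsto (fun n : ℕ =>
        Real.sqrt (11 / 10 * ((n : ℝ) * PoissonLD.nu1 (P n) (X n) ^ 3))) atTop (𝓝 0) := by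
      simpa using (hq.const_mul (11 / 10)).sqrt
    refine squeeze_zero' (hbasic.mono fun n h => h.1.le) (hbasic.mono fun n h => ?_) h2
    apply Real.le_sqrt_of_sq_le
    nlinarith [sq_nonneg (PoissonLD.nu1 (P n) (X n))]
  -- The gap `n ν₁ - n λ*` between the two Poisson parameters.
  set d : ℕ → ℝ := fun n => PoissonLD.nu1 (P n) (X n) / (1 - PoissonLD.nu1 (P n) (X n)) *
    ((x n : ℝ) - n * PoissonLD.nu1 (P n) (X n)) with hd
  have hlam : ∀ᶠ n : ℕ in atTop, (n : ℝ) * PoissonLD.lamStar n (P n) (X n) (x n) =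
      n * PoissonLD.nu1 (P n) (X n) - d n := by
    filter_upwards [hbasic, eventually_gt_atTop 0] with n h hn
    have hn0 : (n : ℝ) ≠ 0 := by exact_mod_cast hn.ne'
    have hp := h.1.ne'
    have h1 : 1 - PoissonLD.nu1 (P n) (X n) ≠ 0 := by linarith [h.2.1]
    simp only [hd, PoissonLD.lamStar, PoissonLD.yParam]
    field_simp
  have hd0 : ∀ᶠ n : ℕ in atTop, 0 ≤ d n := by
    filter_upwards [hbasic, hx] with n h hxn
    have h1 : 0 ≤ 1 - PoissonLD.nu1 (P n) (X n) := by linarith [h.2.1]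
    exact mul_nonneg (div_nonneg h.1.le h1) (by linarith)
  have hxle : ∀ᶠ n : ℕ in atTop, (x n : ℝ) - n * PoissonLD.nu1 (P n) (X n) ≤
      B * Real.sqrt (n * PoissonLD.nu1 (P n) (X n)) := by
    filter_upwards [hB] with n h
    rw [Real.norm_eq_abs, Real.norm_eq_abs, abs_of_nonneg (Real.sqrt_nonneg _)] at h
    exact (le_abs_self _).trans h
  have hdlim : Tendsto d atTop (𝓝 0) := by
    have h2 : Tendsto (fun n : ℕ =>
        2 * B * Real.sqrt ((n : ℝ) * PoissonLD.nu1 (P n) (X n) ^ 3)) atTop (𝓝 0) := by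
      simpa using (hq.sqrt).const_mul (2 * B)
    refine squeeze_zero' hd0 ?_ h2
    filter_upwards [hbasic, hxle, hx] with n h hxn hxp
    have h1 : PoissonLD.nu1 (P n) (X n) / (1 - PoissonLD.nu1 (P n) (X n)) ≤
        2 * PoissonLD.nu1 (P n) (X n) := by
      rw [div_le_iff₀ (by linarith [h.2.1])]
      nlinarith [h.1, h.2.1]
    have hp := h.1.le
    have h3 : Real.sqrt ((n : ℝ) * PoissonLD.nu1 (P n) (X n) ^ 3) =
        PoissonLD.nu1 (P n) (X n) * Real.sqrt (n * PoissonLD.nu1 (P n) (X n)) := by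
      rw [show (n : ℝ) * PoissonLD.nu1 (P n) (X n) ^ 3 =
        PoissonLD.nu1 (P n) (X n) ^ 2 * (n * PoissonLD.nu1 (P n) (X n)) by ring,
        Real.sqrt_mul (sq_nonneg _), Real.sqrt_sq hp]
    calc d n ≤ 2 * PoissonLD.nu1 (P n) (X n) *
          (B * Real.sqrt (n * PoissonLD.nu1 (P n) (X n))) :=
          mul_le_mul h1 hxn (by linarith) (by positivity)
      _ = _ := by rw [h3]; ring
  have hK0 : ∀ᶠ n : ℕ in atTop, PoissonLD.nu2 (P n) (X n) ≤ K * PoissonLD.nu1 (P n) (X n) ^ 2 ∧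
      PoissonLD.mixedMoment (P n) (X n) 1 ≤ K * PoissonLD.nu1 (P n) (X n) ^ 2 := by
    filter_upwards [hK] with n h
    rw [Real.norm_eq_abs, Real.norm_eq_abs, abs_of_nonneg (sq_nonneg (PoissonLD.nu1 _ _))] at h
    have h1 := (le_abs_self _).trans h
    have h2 : (1 : ℝ) ≤ Real.exp (1.5 * C₀) := Real.one_le_exp (by linarith)
    set m := max (PoissonLD.nu1 (P n) (X n) ^ 2) (max (PoissonLD.nu2 (P n) (X n))
      (PoissonLD.mixedMoment (P n) (X n) 1)) with hm
    have hm0 : 0 ≤ m := (sq_nonneg _).trans (le_max_left _ _)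
    have h3 : m ≤ K * PoissonLD.nu1 (P n) (X n) ^ 2 :=
      (le_mul_of_one_le_left hm0 h2).trans h1
    exact ⟨((le_max_left _ _).trans (le_max_right _ _)).trans h3,
      ((le_max_right _ _).trans (le_max_right _ _)).trans h3⟩
  -- The Chen–Stein error, with `ν₂` and `E X₁X₂` at most `K ν₁²`, plus the cost of changing the
  -- parameter.
  set e : ℕ → ℝ := fun n => (3 * K + 3) * PoissonLD.nu1 (P n) (X n) + (Real.exp (d n) - 1) with he
  have helim : Tendsto (fun n => Real.exp (d n) - 1) atTop (𝓝 0) := by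
    have := (Real.continuous_exp.tendsto 0).comp hdlim
    simpa using this.sub_const 1
  have helim' : Tendsto e atTop (𝓝 0) := by
    simpa using (hν0.const_mul (3 * K + 3)).add helim
  set c := 3 / 4 * Real.exp (-((B + 5) * (B + 7))) with hc
  have hc0 : 0 < c := by positivity
  have hdlt : ∀ᶠ n : ℕ in atTop, d n < 10 / 11 := hdlim.eventually_lt_const (by norm_num)
  have hden : ∀ᶠ n : ℕ in atTop,
      (poissonMeasure (Real.toNNReal (n * PoissonLD.lamStar n (P n) (X n) (x n)))).real
        (Set.Ici (x n)) =
      1 - PoissonLD.poissonBelow (n * PoissonLD.nu1 (P n) (X n) - d n) (x n) := by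
    filter_upwards [hlam, hbasic, hdlt] with n h1 h2 h3
    rw [h1, PoissonLD.poissonMeasure_real_Ici _ (by linarith [h2.2.2])]
  have hpert : ∀ᶠ n : ℕ in atTop,
      |PoissonLD.poissonBelow (n * PoissonLD.nu1 (P n) (X n) - d n) (x n) -
        PoissonLD.poissonBelow (n * PoissonLD.nu1 (P n) (X n)) (x n)| ≤ Real.exp (d n) - 1 := by
    filter_upwards [hd0, hbasic, hdlt] with n h1 h2 h3
    exact PoissonLD.abs_poissonBelow_sub_le h1 (by linarith [h2.2.2]) _
  -- `c` bounds the tail at parameter `n ν₁`; half of it survives the change to `n λ*` once `e^d - 1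
  -- < c / 2`.
  refine PoissonLD.tendsto_div_one_of_abs_sub_le (half_pos hc0) helim' ?_ ?_
  · filter_upwards [hset, hx, hden, hpert, hK0, hbasic, eventually_gt_atTop 0]
      with n hs hxn h1 h2 h3 h4 hn
    have h5 := hs.abs_tail_sub_le (by linarith) hn hxn
    have h6 : 1 / ((n : ℝ) * PoissonLD.nu1 (P n) (X n)) * (n * (PoissonLD.nu2 (P n) (X n) +
        2 * PoissonLD.mixedMoment (P n) (X n) 1 + 3 * PoissonLD.nu1 (P n) (X n) ^ 2)) ≤
        (3 * K + 3) * PoissonLD.nu1 (P n) (X n) := by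
      have hn0 : (0 : ℝ) < n := by exact_mod_cast hn
      have hp := h4.1
      rw [one_div, ← div_eq_inv_mul, div_le_iff₀ (by positivity)]
      calc (n : ℝ) * (PoissonLD.nu2 (P n) (X n) + 2 * PoissonLD.mixedMoment (P n) (X n) 1 +
            3 * PoissonLD.nu1 (P n) (X n) ^ 2)
          ≤ n * ((3 * K + 3) * PoissonLD.nu1 (P n) (X n) ^ 2) := by
            gcongr
            linarith [h3.1, h3.2]
        _ = _ := by ring
    rw [h1]
    have h7 := abs_le.1 h5
    have h8 := abs_le.1 h2
    simp only [he]
    rw [abs_le]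
    constructor <;> linarith [h7.1, h7.2, h8.1, h8.2]
  · filter_upwards [hden, hpert, hbasic, hxle, helim.eventually_lt_const (half_pos hc0)]
      with n h1 h2 h3 h4 h5
    rw [h1]
    have h6 := PoissonLD.poisson_tail_lower h3.2.2 hB0 (x n) (by linarith)
    have h7 := abs_le.1 h2
    linarith [h7.1, h7.2]
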